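/- Let $R$ be an associative ring with $1$; modules are left modules. A multiplicative set of a ring contains $1$, is closed under products and does not contain $0$. A left denominator set of $R$ is a multiplicative set $S$ such that for all $r\in R$, $s\in S$ there are $r'\in R$, $s'\in S$ with $s'r=r's$, and such that $rs=0$ with $r\in R$, $s\in S$ implies $tr=0$ for some $t\in S$; then the left localization $S^{-1}R$ exists. For a nonempty set $S\subseteq R$ put $\mathrm{ass}_R(S)=\{r\in R : sr=0 \text{ for some } s\in S\}$; this is a two-sided ideal when $S$ is a left denominator set. Let $'\mathcal C_R=\{c\in R : xc=0\Rightarrow x=0 \text{ for all } x\in R\}$ be the set of left regular elements of $R$, let $\mathfrak a=\mathrm{ass}_R('\mathcal C_R)$, and for a ring $A$ let $\mathcal C_A$ be the set of regular elements of $A$ (those that are neither left nor right zero divisors). Let $'Q_{l,cl}(R)={}'\mathcal C_R^{-1}R$ be the classical left regular left quotient ring of $R$; by definition it exists if and only if $'\mathcal C_R$ is a left denominator set of $R$. For subsets $S\subseteq T$ of a ring $A$, $S$ is called dense in $T$ if for each $t\in T$ there is $r\in A$ with $rt\in S$. Theorem. The following statements are equivalent. 1. The ring $'Q_{l,cl}(R)$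 exists and is a semisimple Artinian ring. 2. There are an integer $n\ge 1$ and left denominator sets $S_1,\dots,S_n$ of $R$ such that (a) each ring $S_i^{-1}R$ is a simple (left) Artinian ring; (b) $\mathfrak a=\bigcap_{i=1}^n \mathrm{ass}_R(S_i)$ (so that $\mathfrak a$ is a two-sided ideal of $R$); and (c) $\pi('\mathcal C_R)\subseteq \mathcal C_{R/\mathfrak a}$, and $\pi('\mathcal C_R)$ is dense in $\mathcal C_{R/\mathfrak a}$, where $\pi:R\to R/\mathfrak a$ is the canonical map. -/

import Mathlib

/-- A left denominator set of a ring `R`: a multiplicative set (`1 ∈ S`, `S S ⊆ S`, `0 ∉ S`) which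
is a left Ore set (`S r ∩ R s ≠ ∅` for all `r ∈ R`, `s ∈ S`) and is left reversible
(`r s = 0` with `s ∈ S` implies `t r = 0` for some `t ∈ S`). -/
structure IsLeftDenominatorSet {R : Type*} [Ring R] (S : Submonoid R) : Prop where
  zero_notMem : (0 : R) ∉ S
  ore : ∀ r : R, ∀ s ∈ S, ∃ r' : R, ∃ s' ∈ S, s' * r = r' * s
  reversible : ∀ r : R, ∀ s ∈ S, r * s = 0 → ∃ t ∈ S, t * r = 0

/-- A left denominator set satisfies the conditions under which Mathlib constructs the left
localization. -/
theorem IsLeftDenominatorSet.nonempty_oreSet {R : Type*} [Ring R] {S : Submonoid R}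
    (h : IsLeftDenominatorSet S) : Nonempty (OreLocalization.OreSet S) := by
  rw [OreLocalization.nonempty_oreSet_iff]
  refine ⟨fun r₁ r₂ s hs => ?_, fun r s => ?_⟩
  · obtain ⟨t, ht, h0⟩ := h.reversible (r₁ - r₂) s s.2 (by rw [sub_mul, hs, sub_self])
    exact ⟨⟨t, ht⟩, by rwa [mul_sub, sub_eq_zero] at h0⟩
  · obtain ⟨r', s', hs', e⟩ := h.ore r s s.2
    exact ⟨r', ⟨s', hs'⟩, e⟩

/-- A choice of Ore numerators and denominators; the localization does not depend on it. -/
noncomputable abbrev IsLeftDenominatorSet.oreSet {R : Type*} [Ring R] {S : Submonoid R}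
    (h : IsLeftDenominatorSet S) : OreLocalization.OreSet S :=
  Classical.choice h.nonempty_oreSet

/-- The left localization `S⁻¹R` of `R` at a left denominator set `S`. -/
abbrev LeftLocalization {R : Type*} [Ring R] {S : Submonoid R}
    (h : IsLeftDenominatorSet S) : Type _ :=
  letI := h.oreSet
  OreLocalization S R

noncomputable instance LeftLocalization.instRing {R : Type*} [Ring R] {S : Submonoid R}
    (h : IsLeftDenominatorSet S) : Ring (LeftLocalization h) :=
  letI := h.oreSet
  inferInstanceAs (Ring (OreLocalization S R))

/-- The multiplicative set of left regular elements of `R`: the `r` for which right multiplication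
`x ↦ x * r` is injective. -/
abbrev leftRegularElements (R : Type*) [Ring R] : Submonoid R :=
  nonZeroDivisorsRight R

/-- `ass_R(S)`, the set of `r ∈ R` with `s r = 0` for some `s ∈ S`. For a general multiplicative
set it need not be an ideal. -/
def assSet {R : Type*} [Ring R] (S : Submonoid R) : Set R :=
  {r | ∃ s ∈ S, s * r = 0}

/-- `S` is a (left) dense subset of `T`: `S ⊆ T`, and each `t ∈ T` has a left multiple `r t`,
`r ∈ R`, in `S`. -/
def IsLeftDenseIn {R : Type*} [Ring R] (S T : Submonoid R) : Prop :=
  S ≤ T ∧ ∀ t ∈ T, ∃ r : R, r * t ∈ S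

/-- The classical left regular left quotient ring of `R`, i.e. the left localization of `R` at its
left regular elements, exists and is semisimple Artinian.
(`IsSemisimpleRing`, for a ring with 1, includes the Artinian condition.) -/
def HasSemisimpleLeftRegularQuotient (R : Type*) [Ring R] : Prop :=
  ∃ h : IsLeftDenominatorSet (leftRegularElements R), IsSemisimpleRing (LeftLocalization h)

/-! If the quotient ring is semisimple, Wedderburn–Artin splits it into matrix rings. Each factor is
a localization of `R` at the elements invertible in it (`eval_comp`), and the kernels meet in `𝔞`.
Regular elements modulo `𝔞` become units because the quotient ring is Artinian, which gives density
(`isLeftDenseIn`).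

Conversely, discard redundant `S i`. For each remaining factor, simplicity yields an element of `R`
that is a unit there and zero in the others. These elements glue fractions, so the product consists
of left fractions of `R` (`exists_pi_mul_eq`), and density makes the denominators left regular
(`of_isLeftDenseIn`). -/

/-- A ring homomorphism `φ : R →+* Q` exhibits `Q` as the left localization of `R` at `S`: it
inverts `S`, every element of `Q` is a left fraction, and its kernel is killed by `S`. -/
structure IsLeftFractionHom {R Q : Type*} [Ring R] [Ring Q] (S : Submonoid R) (φ : R →+* Q) :
    Prop where
  isUnit : ∀ s ∈ S, IsUnit (φ s)
  exists_mul_eq : ∀ q : Q, ∃ s ∈ S, ∃ r : R, φ s * q = φ r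
  exists_mul_eq_zero : ∀ r : R, φ r = 0 → ∃ s ∈ S, s * r = 0

namespace IsLeftFractionHom

variable {R Q : Type*} [Ring R] [Ring Q] {S : Submonoid R} {φ : R →+* Q}

theorem map_eq_zero_iff (h : IsLeftFractionHom S φ) (r : R) : φ r = 0 ↔ r ∈ assSet S := by
  refine ⟨h.exists_mul_eq_zero r, ?_⟩
  rintro ⟨s, hs, e⟩
  rw [← (h.isUnit s hs).mul_right_eq_zero, ← map_mul, e, map_zero]

/-- A localization in this sense comes from a left denominator set. -/
theorem isLeftDenominatorSet [Nontrivial Q] (h : IsLeftFractionHom S φ) :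
    IsLeftDenominatorSet S where
  zero_notMem h0 := not_isUnit_zero (M₀ := Q) (by simpa using h.isUnit 0 h0)
  ore r s hs := by
    obtain ⟨u, hu⟩ := h.isUnit s hs
    -- Rewriting the right fraction `r s⁻¹` as a left one gives the Ore relation modulo the kernel.
    obtain ⟨s', hs', r', e⟩ := h.exists_mul_eq (φ r * ↑u⁻¹)
    have e0 : φ (s' * r - r' * s) = 0 := by
      rw [map_sub, map_mul, map_mul, ← e, ← hu]
      simp [mul_assoc]
    obtain ⟨t, ht, e'⟩ := h.exists_mul_eq_zero _ e0
    refine ⟨t * r', t * s', mul_mem ht hs', ?_⟩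
    rwa [mul_sub, sub_eq_zero, ← mul_assoc, ← mul_assoc] at e'
  reversible r s hs e := by
    refine h.exists_mul_eq_zero r ?_
    rw [← (h.isUnit s hs).mul_left_eq_zero, ← map_mul, e, map_zero]

theorem trans_ringEquiv {Q' : Type*} [Ring Q'] (h : IsLeftFractionHom S φ) (e : Q ≃+* Q') :
    IsLeftFractionHom S ((e : Q →+* Q').comp φ) where
  isUnit s hs := (h.isUnit s hs).map e
  exists_mul_eq q := by
    obtain ⟨s, hs, r, hr⟩ := h.exists_mul_eq (e.symm q)
    exact ⟨s, hs, r, by simpa using congrArg e hr⟩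
  exists_mul_eq_zero r hr := h.exists_mul_eq_zero r (by simpa using hr)

/-- A left fraction ring which is left Artinian inverts every `c` that is a non-zero-divisor on the
left modulo the kernel. -/
theorem isUnit_of_isArtinianRing [IsArtinianRing Q]
    (hφ : ∀ q : Q, ∃ s r : R, IsUnit (φ s) ∧ φ s * q = φ r) {c : R}
    (hc : ∀ r : R, φ (r * c) = 0 → φ r = 0) : IsUnit (φ c) := by
  -- Right multiplication is left linear, so over a left Artinian ring its injectivity suffices.
  rw [IsArtinianRing.isUnit_iff_isRightRegular, isRightRegular_iff_left_eq_zero_of_mul]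
  intro q hq
  obtain ⟨s, r, hs, e⟩ := hφ q
  rw [← hs.mul_right_eq_zero, e]
  exact hc r (by rw [map_mul, ← e, mul_assoc, hq, mul_zero])

end IsLeftFractionHom

/-! ### Ore localizations as fraction homomorphisms -/

namespace LeftLocalization

variable {R : Type*} [Ring R] {S : Submonoid R}

theorem exists_isLeftFractionHom (h : IsLeftDenominatorSet S) :
    ∃ φ : R →+* LeftLocalization h, IsLeftFractionHom S φ := by
  let := h.oreSet
  refine ⟨(OreLocalization.numeratorRingHom : R →+* OreLocalization S R), ?_, ?_, ?_⟩
  · exact fun s hs => OreLocalization.numerator_isUnit ⟨s, hs⟩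
  · intro q
    induction q using OreLocalization.ind with
    | _ r s =>
      refine ⟨s, s.2, r, ?_⟩
      change (OreLocalization.numeratorHom (s : R) : OreLocalization S R) * _ =
        OreLocalization.numeratorHom r
      simp [OreLocalization.numeratorHom_apply]
  · intro r hr
    have hr' : (r /ₒ (1 : S) : OreLocalization S R) = 0 := hr
    rw [OreLocalization.zero_def, OreLocalization.oreDiv_eq_iff] at hr'
    obtain ⟨u, v, e, e'⟩ := hr'
    refine ⟨u, u.2, ?_⟩
    have e'' : (u : R) = v := by simpa using e'
    rw [e'']
    simpa using e.symm

/-- The universal property of the left localization, in the form of uniqueness. -/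
theorem nonempty_ringEquiv {Q : Type*} [Ring Q] {φ : R →+* Q} (h : IsLeftDenominatorSet S)
    (hφ : IsLeftFractionHom S φ) : Nonempty (LeftLocalization h ≃+* Q) := by
  let := h.oreSet
  let f : S →* Qˣ := IsUnit.liftRight ((φ : R →* Q).comp S.subtype) fun s => hφ.isUnit s s.2
  have hf (s : S) : φ s = f s := rfl
  let ψ : OreLocalization S R →+* Q := OreLocalization.universalHom φ f hf
  have hψ (r : R) (s : S) : ψ (r /ₒ s) = ((f s)⁻¹ : Qˣ) * φ r :=
    OreLocalization.universalHom_apply φ f hf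
  refine ⟨RingEquiv.ofBijective ψ ⟨(injective_iff_map_eq_zero ψ).2 fun x hx => ?_, fun q => ?_⟩⟩
  · induction x using OreLocalization.ind with
    | _ r s =>
      rw [hψ, Units.mul_right_eq_zero] at hx
      obtain ⟨t, ht, e⟩ := hφ.exists_mul_eq_zero r hx
      rw [OreLocalization.expand' r s ⟨t, ht⟩, Submonoid.smul_def, smul_eq_mul, e,
        OreLocalization.zero_oreDiv]
  · obtain ⟨s, hs, r, e⟩ := hφ.exists_mul_eq q
    exact ⟨r /ₒ ⟨s, hs⟩, by rw [hψ, ← e, hf ⟨s, hs⟩, Units.inv_mul_cancel_left]⟩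

end LeftLocalization

/-! ### Products, extended ideals and dense denominators -/

namespace IsLeftFractionHom

/-- If a product of nontrivial rings is a left fraction ring of `R`, then so is each factor, with
denominators the elements of `R` which become invertible in that factor. -/
theorem eval_comp {R ι : Type*} [Ring R] [DecidableEq ι] {Q : ι → Type*} [∀ i, Ring (Q i)]
    {S : Submonoid R} {φ : R →+* ∀ i, Q i} (h : IsLeftFractionHom S φ) (i : ι) :
    IsLeftFractionHom ((IsUnit.submonoid (Q i)).comap ((Pi.evalRingHom Q i).comp φ))
      ((Pi.evalRingHom Q i).comp φ) where
  isUnit s hs := hs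
  exists_mul_eq q := by
    obtain ⟨s, hs, r, e⟩ := h.exists_mul_eq (Pi.single i q)
    exact ⟨s, (h.isUnit s hs).map (Pi.evalRingHom Q i), r, by simpa using congrFun e i⟩
  exists_mul_eq_zero r hr := by
    have hr : φ r i = 0 := hr
    -- The numerator `x` of the central idempotent is a unit at `i` and zero elsewhere, so `x * r`
    -- lies in the full kernel.
    obtain ⟨s, hs, x, e⟩ := h.exists_mul_eq (Pi.single i 1)
    have hx : IsUnit (φ x i) := by
      rw [← e, Pi.mul_apply, Pi.single_eq_same, mul_one]
      exact (h.isUnit s hs).map (Pi.evalRingHom Q i)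
    have h0 : φ (x * r) = 0 := by
      rw [map_mul, ← e, mul_assoc, ← Pi.single_mul_left, hr, mul_zero, Pi.single_zero, mul_zero]
    obtain ⟨c, hc, e'⟩ := h.exists_mul_eq_zero _ h0
    refine ⟨c * x, ?_, by rw [mul_assoc, e']⟩
    exact Submonoid.mul_mem _ ((h.isUnit c hc).map (Pi.evalRingHom Q i)) hx

variable {R Q : Type*} [Ring R] [Ring Q] {S : Submonoid R} {φ : R →+* Q}

/-- The extension `S⁻¹I` of an ideal `I` to a left fraction ring, as a left ideal. -/
def extension [Nontrivial Q] (h : IsLeftFractionHom S φ) (I : Ideal R) : Ideal Q where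
  carrier := {q | ∃ s ∈ S, ∃ b ∈ I, φ s * q = φ b}
  zero_mem' := ⟨1, one_mem S, 0, zero_mem I, by simp⟩
  add_mem' := by
    rintro p q ⟨s, hs, b, hb, e⟩ ⟨t, ht, c, hc, e'⟩
    obtain ⟨r', s', hs', eo⟩ := h.isLeftDenominatorSet.ore s t ht
    refine ⟨s' * s, mul_mem hs' hs, s' * b + r' * c,
      add_mem (I.mul_mem_left _ hb) (I.mul_mem_left _ hc), ?_⟩
    rw [mul_add]
    nth_rw 2 [eo]
    simp only [map_mul, map_add, mul_assoc, e, e']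
  smul_mem' := by
    rintro x q ⟨t, ht, c, hc, e'⟩
    obtain ⟨s, hs, r, e⟩ := h.exists_mul_eq x
    obtain ⟨r', s', hs', eo⟩ := h.isLeftDenominatorSet.ore r t ht
    refine ⟨s' * s, mul_mem hs' hs, r' * c, I.mul_mem_left _ hc, ?_⟩
    rw [smul_eq_mul, map_mul, mul_assoc, ← mul_assoc (φ s), e, ← mul_assoc, ← map_mul, eo,
      map_mul, mul_assoc, e', map_mul]

theorem mem_extension [Nontrivial Q] (h : IsLeftFractionHom S φ) (I : Ideal R) {q : Q} :
    q ∈ h.extension I ↔ ∃ s ∈ S, ∃ b ∈ I, φ s * q = φ b :=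
  Iff.rfl

/-- Over a left Artinian left fraction ring, two-sided ideals extend to two-sided ideals. -/
theorem isTwoSided_extension [Nontrivial Q] [IsArtinianRing Q] (h : IsLeftFractionHom S φ)
    (I : Ideal R) [I.IsTwoSided] : (h.extension I).IsTwoSided := by
  have hmul {q : Q} (hq : q ∈ h.extension I) (r : R) : q * φ r ∈ h.extension I := by
    obtain ⟨s, hs, b, hb, e⟩ := hq
    exact ⟨s, hs, b * r, I.mul_mem_right r hb, by rw [← mul_assoc, e, map_mul]⟩
  refine ⟨fun {q} x hq => ?_⟩
  obtain ⟨s, hs, r, e⟩ := h.exists_mul_eq x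
  -- Right multiplication by the unit `φ s` is injective on the extension, hence surjective; so `q =
  -- p * φ s` and `q * x = p * φ r`.
  let f : h.extension I →ₗ[Q] h.extension I :=
    (LinearMap.toSpanSingleton Q Q (φ s)).restrict fun q hq => hmul hq s
  have hf : Function.Injective f := fun p q hpq =>
    Subtype.ext ((h.isUnit s hs).mul_left_injective (congrArg Subtype.val hpq))
  obtain ⟨p, hp⟩ := IsArtinian.surjective_of_injective_endomorphism f hf ⟨q, hq⟩
  have hp' : (p : Q) * φ s = q := congrArg Subtype.val hp
  rw [← hp', mul_assoc, e]
  exact hmul p.2 r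

/-- If a left fraction ring is simple and left Artinian, then a two-sided ideal outside the kernel
contains an element which becomes invertible. -/
theorem exists_mem_isUnit [IsSimpleRing Q] [IsArtinianRing Q] (h : IsLeftFractionHom S φ)
    (I : Ideal R) [I.IsTwoSided] {b : R} (hb : b ∈ I) (hb0 : φ b ≠ 0) :
    ∃ c ∈ I, IsUnit (φ c) := by
  have htop : h.extension I = ⊤ := by
    refine ((isSimpleRing_iff_isTwoSided_imp.mp ‹_›).2 _ (h.isTwoSided_extension I)).resolve_left
      fun hbot => hb0 ?_
    rw [← Ideal.mem_bot, ← hbot]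
    exact ⟨1, one_mem S, b, hb, by simp⟩
  obtain ⟨s, hs, c, hc, e⟩ := (h.mem_extension I).1 (htop ▸ Submodule.mem_top : 1 ∈ h.extension I)
  exact ⟨c, hc, by rw [← e, mul_one]; exact h.isUnit s hs⟩

/-- For an irredundant finite family of simple left Artinian left fraction rings of `R`, the
elements of the product are left fractions of elements of `R`. -/
theorem exists_pi_mul_eq {ι : Type*} [Finite ι] {Q : ι → Type*} [∀ i, Ring (Q i)]
    [∀ i, IsSimpleRing (Q i)] [∀ i, IsArtinianRing (Q i)] {S : ι → Submonoid R}
    {φ : ∀ i, R →+* Q i} (h : ∀ i, IsLeftFractionHom (S i) (φ i))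
    (hirr : ∀ i, ∃ b, φ i b ≠ 0 ∧ ∀ j ≠ i, φ j b = 0) (q : ∀ i, Q i) :
    ∃ s r : R, IsUnit (RingHom.pi φ s) ∧ RingHom.pi φ s * q = RingHom.pi φ r := by
  classical
  have := Fintype.ofFinite ι
  have hc (i : ι) : ∃ c, IsUnit (φ i c) ∧ ∀ j ≠ i, φ j c = 0 := by
    obtain ⟨b, hb, hbj⟩ := hirr i
    -- The ideal is the intersection of the other kernels.
    obtain ⟨c, hc, hu⟩ := (h i).exists_mem_isUnit
      (RingHom.ker (RingHom.pi fun j : {j // j ≠ i} => φ j)) (b := b)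
      (funext fun j => hbj j j.2) hb
    exact ⟨c, hu, fun j hj => congrFun hc ⟨j, hj⟩⟩
  choose c hcu hc0 using hc
  choose s hs r hr using fun i => (h i).exists_mul_eq (q i)
  have hsum (x : ι → R) (i : ι) : φ i (∑ j, c j * x j) = φ i (c i) * φ i (x i) := by
    rw [map_sum, Finset.sum_eq_single i, map_mul]
    · exact fun j _ hj => by rw [map_mul, hc0 j i hj.symm, zero_mul]
    · exact fun hi => absurd (Finset.mem_univ i) hi
  refine ⟨∑ j, c j * s j, ∑ j, c j * r j, Pi.isUnit_iff.2 fun i => ?_, funext fun i => ?_⟩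
  · rw [RingHom.pi_apply, hsum]
    exact (hcu i).mul ((h i).isUnit _ (hs i))
  · rw [Pi.mul_apply, RingHom.pi_apply, RingHom.pi_apply, hsum, hsum, mul_assoc, hr]

/-- If `R ⧸ 𝔞` has left fraction ring `Q`, where `𝔞` is the kernel associated with the left regular
elements, and their images are dense in the regular elements of `R ⧸ 𝔞`, then `Q` is the left
localization at the left regular elements. -/
theorem of_isLeftDenseIn [IsArtinianRing Q] {𝔞 : Ideal R} [𝔞.IsTwoSided]
    (hker : ∀ r, φ r = 0 ↔ r ∈ 𝔞) (h𝔞 : (𝔞 : Set R) = assSet (leftRegularElements R))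
    (hdense : IsLeftDenseIn ((leftRegularElements R).map (Ideal.Quotient.mk 𝔞))
      (nonZeroDivisors (R ⧸ 𝔞)))
    (hφ : ∀ q : Q, ∃ s r : R, IsUnit (φ s) ∧ φ s * q = φ r) :
    IsLeftFractionHom (leftRegularElements R) φ where
  isUnit c hc := by
    refine isUnit_of_isArtinianRing hφ fun r hr => ?_
    rw [hker, ← Ideal.Quotient.eq_zero_iff_mem] at hr ⊢
    rw [map_mul] at hr
    exact (mem_nonZeroDivisors_iff.1 (hdense.1 (Submonoid.mem_map_of_mem _ hc))).2 _ hr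
  exists_mul_eq_zero r hr := by
    have : r ∈ (𝔞 : Set R) := (hker r).1 hr
    rwa [h𝔞] at this
  exists_mul_eq q := by
    obtain ⟨s, r, hs, e⟩ := hφ q
    have hs' : Ideal.Quotient.mk 𝔞 s ∈ nonZeroDivisors (R ⧸ 𝔞) := by
      refine mem_nonZeroDivisors_iff.2 ⟨fun x hx => ?_, fun x hx => ?_⟩ <;>
        obtain ⟨x, rfl⟩ := Ideal.Quotient.mk_surjective x <;>
        rw [← map_mul, Ideal.Quotient.eq_zero_iff_mem, ← hker, map_mul] at hx <;>
        rw [Ideal.Quotient.eq_zero_iff_mem, ← hker]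
      · rwa [hs.mul_right_eq_zero] at hx
      · rwa [hs.mul_left_eq_zero] at hx
    obtain ⟨x, c, hc, hx⟩ := hdense.2 _ hs'
    obtain ⟨x, rfl⟩ := Ideal.Quotient.mk_surjective x
    rw [← map_mul, Eq.comm, Ideal.Quotient.eq] at hx
    -- Multiplying by `t` turns the congruence into `t * x * s = t * c`, a left regular multiple of
    -- `s`.
    obtain ⟨t, ht, e'⟩ : x * s - c ∈ assSet (leftRegularElements R) := by rwa [← h𝔞]
    rw [mul_sub, sub_eq_zero] at e'
    refine ⟨t * c, mul_mem ht hc, t * x * r, ?_⟩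
    rw [← e', ← mul_assoc, map_mul, mul_assoc, e, ← map_mul]

/-- If a left Artinian ring `Q` is the left localization at the left regular elements, their images
modulo the associated ideal are dense in the regular elements. -/
theorem isLeftDenseIn [IsArtinianRing Q] (h : IsLeftFractionHom (leftRegularElements R) φ) :
    IsLeftDenseIn ((leftRegularElements R).map (Ideal.Quotient.mk (RingHom.ker φ)))
      (nonZeroDivisors (R ⧸ RingHom.ker φ)) := by
  refine ⟨?_, fun t ht => ?_⟩
  · rintro _ ⟨c, hc, rfl⟩
    have hu := h.isUnit c hc
    refine mem_nonZeroDivisors_iff.2 ⟨fun x hx => ?_, fun x hx => ?_⟩ <;>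
      obtain ⟨x, rfl⟩ := Ideal.Quotient.mk_surjective x <;>
      rw [← map_mul, Ideal.Quotient.eq_zero_iff_mem, RingHom.mem_ker, map_mul] at hx <;>
      rw [Ideal.Quotient.eq_zero_iff_mem, RingHom.mem_ker]
    · rwa [hu.mul_right_eq_zero] at hx
    · rwa [hu.mul_left_eq_zero] at hx
  · obtain ⟨t, rfl⟩ := Ideal.Quotient.mk_surjective t
    have hu : IsUnit (φ t) := by
      refine isUnit_of_isArtinianRing (fun q => ?_) fun r hr => ?_
      · obtain ⟨s, hs, r, e⟩ := h.exists_mul_eq q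
        exact ⟨s, r, h.isUnit s hs, e⟩
      · rw [← RingHom.mem_ker, ← Ideal.Quotient.eq_zero_iff_mem] at hr ⊢
        rw [map_mul] at hr
        exact (mem_nonZeroDivisors_iff.1 ht).2 _ hr
    obtain ⟨u, hu⟩ := hu
    obtain ⟨c, hc, r, e⟩ := h.exists_mul_eq ↑u⁻¹
    refine ⟨Ideal.Quotient.mk _ r, c, hc, ?_⟩
    rw [← map_mul, Ideal.Quotient.eq, RingHom.mem_ker, map_sub, map_mul, ← e, ← hu,
      Units.inv_mul_cancel_right, sub_self]

end IsLeftFractionHom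

/-! ### Irredundant subfamilies and the equivalence -/

/-- Any finite intersection of sets is the intersection of an irredundant subfamily. -/
theorem exists_finset_irredundant_iInter {α ι : Type*} [Fintype ι] (A : ι → Set α) :
    ∃ I : Finset ι, ⋂ i ∈ I, A i = ⋂ i, A i ∧
      ∀ i ∈ I, ∃ b ∉ A i, ∀ j ∈ I, j ≠ i → b ∈ A j := by
  classical
  obtain ⟨I, hI⟩ := exists_minimal_of_wellFoundedLT
    (fun I : Finset ι => ⋂ i ∈ I, A i = ⋂ i, A i) ⟨Finset.univ, by simp⟩
  refine ⟨I, hI.prop, fun i hi => ?_⟩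
  by_contra! hcon
  -- Were `i` redundant, `I.erase i` would have the same intersection, so by minimality it would
  -- contain `I`.
  refine absurd hi fun _ => Finset.notMem_erase i I (hI.le_of_le (y := I.erase i) ?_
    (Finset.erase_subset i I) hi)
  rw [← hI.prop]
  refine subset_antisymm (fun b hb => ?_) (fun b hb => ?_)
  · simp only [Set.mem_iInter, Finset.mem_erase] at hb ⊢
    intro j hj
    by_cases hji : j = i
    · subst hji
      by_contra hb'
      obtain ⟨k, hk, hkj, hbk⟩ := hcon b hb'
      exact hbk (hb k ⟨hkj, hk⟩)
    · exact hb j ⟨hji, hj⟩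
  · simp only [Set.mem_iInter, Finset.mem_erase] at hb ⊢
    exact fun j hj => hb j hj.2

theorem mainTheorem8 (R : Type*) [Ring R] :
    HasSemisimpleLeftRegularQuotient R ↔
      ∃ n : ℕ, 1 ≤ n ∧ ∃ (S : Fin n → Submonoid R) (hS : ∀ i, IsLeftDenominatorSet (S i)),
        (∀ i, IsSimpleRing (LeftLocalization (hS i)) ∧ IsArtinianRing (LeftLocalization (hS i))) ∧
        assSet (leftRegularElements R) = ⋂ i, assSet (S i) ∧
        ∃ (𝔞 : Ideal R) (_ : 𝔞.IsTwoSided),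
          (𝔞 : Set R) = assSet (leftRegularElements R) ∧
          IsLeftDenseIn ((leftRegularElements R).map (Ideal.Quotient.mk 𝔞))
            (nonZeroDivisors (R ⧸ 𝔞)) := by
  constructor
  · rintro ⟨h, hss⟩
    obtain ⟨φ₀, hφ₀⟩ := LeftLocalization.exists_isLeftFractionHom h
    obtain ⟨n, D, d, _, _, ⟨e⟩⟩ :=
      IsSemisimpleRing.exists_ringEquiv_pi_matrix_divisionRing (LeftLocalization h)
    have hφ := hφ₀.trans_ringEquiv e
    set φ : R →+* ∀ i, Matrix (Fin (d i)) (Fin (d i)) (D i) :=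
      (e : LeftLocalization h →+* _).comp φ₀
    have hn : 1 ≤ n := by
      -- An empty product is the zero ring, which would put `0` among the denominators.
      by_contra! hn
      obtain rfl : n = 0 := by omega
      obtain ⟨s, hs, e'⟩ := hφ.exists_mul_eq_zero 1 (Subsingleton.elim _ _)
      exact h.zero_notMem (by rwa [← e', mul_one])
    have hφi := hφ.eval_comp
    refine ⟨n, hn, _, fun i => (hφi i).isLeftDenominatorSet, fun i => ?_, ?_, RingHom.ker φ,
      inferInstance, ?_, hφ.isLeftDenseIn⟩
    · obtain ⟨ei⟩ := LeftLocalization.nonempty_ringEquiv (hφi i).isLeftDenominatorSet (hφi i)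
      exact ⟨.of_ringEquiv ei.symm inferInstance, ei.symm.isArtinianRing⟩
    · ext r
      rw [← hφ.map_eq_zero_iff, Set.mem_iInter]
      simp only [← (hφi _).map_eq_zero_iff]
      exact funext_iff
    · ext r
      exact hφ.map_eq_zero_iff r
  · rintro ⟨n, hn, S, hS, hQ, hass, 𝔞, _, h𝔞, hdense⟩
    choose φ hφ using fun i => LeftLocalization.exists_isLeftFractionHom (hS i)
    have hsimple (i : Fin n) : IsSimpleRing (LeftLocalization (hS i)) := (hQ i).1
    have hart (i : Fin n) : IsArtinianRing (LeftLocalization (hS i)) := (hQ i).2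
    obtain ⟨I, hI, hirr⟩ := exists_finset_irredundant_iInter fun i => assSet (S i)
    have hfrac := IsLeftFractionHom.exists_pi_mul_eq (fun i : I => hφ i) fun i => by
      obtain ⟨b, hb, hbj⟩ := hirr i i.2
      exact ⟨b, by rwa [Ne, (hφ i).map_eq_zero_iff], fun j hj =>
        ((hφ j).map_eq_zero_iff b).2 (hbj j j.2 (Subtype.coe_ne_coe.2 hj))⟩
    have hC : IsLeftFractionHom (leftRegularElements R) (RingHom.pi fun i : I => φ i) := by
      refine .of_isLeftDenseIn (fun r => ?_) h𝔞 hdense hfrac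
      rw [← SetLike.mem_coe, h𝔞, hass, ← hI, funext_iff]
      simp only [Set.mem_iInter, ← (hφ _).map_eq_zero_iff, Subtype.forall]
      rfl
    have hne : Nonempty I := by
      by_contra hemp
      rw [Finset.nonempty_coe_sort, Finset.not_nonempty_iff_eq_empty] at hemp
      subst hemp
      -- The empty intersection is all of `R`, whereas `1` lies in no `assSet (S i)`.
      have h1 : (1 : R) ∈ ⋂ i, assSet (S i) := by rw [← hI]; simp
      obtain ⟨s, hs, e⟩ := Set.mem_iInter.1 h1 ⟨0, hn⟩
      exact (hS ⟨0, hn⟩).zero_notMem (by rwa [← e, mul_one])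
    have hnt : Nontrivial (∀ i : I, LeftLocalization (hS i)) := Pi.nontrivial_at hne.some
    have h := hC.isLeftDenominatorSet
    obtain ⟨e⟩ := LeftLocalization.nonempty_ringEquiv h hC
    exact ⟨h, e.symm.isSemisimpleRing⟩
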